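/- Let $r$ and $k$ be positive integers with $k\le (2r+1)/3$, and let $G$ be a finite $(2r+1)$-regular multigraph (loops and multiple edges are allowed; a loop contributes $2$ to the degree of its vertex). If $G$ has at most $2r-3(k-1)$ cut-edges, then $G$ has a $2k$-factor, that is, a $2k$-regular spanning subgraph. Here a cut-edge is an edge whose deletion increases the number of components, and $G$ is not assumed to be connected. -/

import Mathlib

open scoped Graph

namespace Graph

/-- The degree of `v` in a multigraph: the number of edges incident to `v`, where every loop at `v`
is counted twice. -/
noncomputable def degree {α β : Type*} (G : Graph α β) (v : α) : ℕ∞ :=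
  {e | G.Inc e v}.encard + {e | G.IsLoopAt e v}.encard

/-- Every vertex has degree `d`. -/
def IsRegular {α β : Type*} (G : Graph α β) (d : ℕ) : Prop :=
  ∀ v ∈ V(G), G.degree v = d

/-- An `l`-factor of `G` is an `l`-regular spanning subgraph of `G`. -/
def IsFactor {α β : Type*} (G : Graph α β) (l : ℕ) (H : Graph α β) : Prop :=
  H ≤s G ∧ H.IsRegular l

/-- `u` and `v` are joined by a walk; for vertices of `G` this says that they lie in the same
component of `G`. -/
def Reachable {α β : Type*} (G : Graph α β) (u v : α) : Prop :=
  Relation.ReflTransGen G.Adj u v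

/-- A cut-edge is an edge whose deletion breaks up a component: some two vertices in the same
component of `G` lie in different components of `G - e`. -/
def IsCutEdge {α β : Type*} (G : Graph α β) (e : β) : Prop :=
  e ∈ E(G) ∧ ∃ u ∈ V(G), ∃ v ∈ V(G),
    G.Reachable u v ∧ ¬ (G.deleteEdges {e}).Reachable u v

/-- The set of cut-edges of `G`. -/
def cutEdges {α β : Type*} (G : Graph α β) : Set β :=
  {e | G.IsCutEdge e}

end Graph

open Finset

/-! Split every edge into two half-edges, one at each end, and join the half-edges at `v` to `m = 2r
+ 1 - 2k` new vertices. A perfect matching of this `gadget` yields a `2k`-factor: the edges whose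
halves are matched to each other. If there is none, Tutte's theorem gives a barrier, and a minimal
one consists of all half-edges at a vertex set `S` and all new vertices at a set `T`
(`exists_barrier`).

A member of the odd family without new vertices over `S` contains an odd number of half-edges at
`T`; if that number is 1 and no edge joins the member to `S`, it yields a cut-edge
(`isSeparatingEdge_of_card_eq_one`). Counting members against the half-edges at `S` and `T` forces
`|T| > |S|` and at least `2r + 4 - 3k` cut-edges, one more than allowed. -/

/-- A family of pairwise disjoint odd vertex sets avoiding `U`, each of which is closed under
adjacency outside `U`. -/
structure SimpleGraph.IsOddFamily {W : Type*} (G : SimpleGraph W) (U : Finset W)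
    (O : Finset (Finset W)) : Prop where
  odd_card : ∀ C ∈ O, Odd C.card
  disj : ∀ C ∈ O, ∀ x ∈ C, x ∉ U
  pairwise : ∀ C ∈ O, ∀ D ∈ O, ∀ x, x ∈ C → x ∈ D → C = D
  closed : ∀ C ∈ O, ∀ x ∈ C, ∀ y, G.Adj x y → y ∉ U → y ∈ C

/-! ### Tutte barriers and their minimality -/

namespace SimpleGraph.IsOddFamily

open scoped Classical in
theorem exists_of_forall_not_isPerfectMatching {W : Type*} [Fintype W] (G : SimpleGraph W)
    (h : ∀ M : G.Subgraph, ¬ M.IsPerfectMatching) :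
    ∃ U O, G.IsOddFamily U O ∧ #U < #O := by
  have h1 : ¬ ∃ M : G.Subgraph, M.IsPerfectMatching := by simpa using h
  rw [SimpleGraph.tutte] at h1
  push Not at h1
  obtain ⟨u, hu⟩ := h1
  let K := ((⊤ : G.Subgraph).deleteVerts u).coe
  let f : K.ConnectedComponent → Finset W := fun c => (Subtype.val '' c.supp).toFinset
  have hmem : ∀ c x, x ∈ f c ↔ ∃ hx : x ∈ ((⊤ : G.Subgraph).deleteVerts u).verts,
      K.connectedComponentMk ⟨x, hx⟩ = c := by
    intro c x
    simp [f]
  have hinj : ∀ c c' x, x ∈ f c → x ∈ f c' → c = c' := by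
    intro c c' x hx hx'
    rw [hmem] at hx hx'
    obtain ⟨_, rfl⟩ := hx
    obtain ⟨_, rfl⟩ := hx'
    rfl
  have hcard : ∀ c, #(f c) = c.supp.ncard := by
    intro c
    rw [← Set.ncard_eq_toFinset_card', Set.ncard_image_of_injective _ Subtype.val_injective]
  refine ⟨u.toFinset, K.oddComponents.toFinset.image f, ⟨?_, ?_, ?_, ?_⟩, ?_⟩
  · simp only [mem_image, Set.mem_toFinset]
    rintro _ ⟨c, hc, rfl⟩
    rw [hcard]
    exact hc
  · simp only [mem_image]
    rintro _ ⟨c, hc, rfl⟩ x hx hxu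
    obtain ⟨hx, -⟩ := (hmem _ _).1 hx
    simp at hx hxu
    exact hx hxu
  · simp only [mem_image]
    rintro _ ⟨c, hc, rfl⟩ _ ⟨c', hc', rfl⟩ x hx hx'
    rw [hinj c c' x hx hx']
  · simp only [mem_image]
    rintro _ ⟨c, hc, rfl⟩ x hx y hxy hy
    rw [hmem] at hx ⊢
    obtain ⟨hx, rfl⟩ := hx
    have hy' : y ∈ ((⊤ : G.Subgraph).deleteVerts u).verts := by simpa using hy
    refine ⟨hy', ConnectedComponent.sound (Adj.reachable ?_)⟩
    have hx2 : x ∉ u := by simpa using hx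
    have hy2 : y ∉ u := by simpa using hy
    simp only [K, Subgraph.coe_adj, Subgraph.deleteVerts_adj]
    simp [hx2, hy2, hxy.symm]
  · rw [card_image_of_injOn, ← Set.ncard_eq_toFinset_card', ← Set.ncard_eq_toFinset_card']
    · exact hu
    · intro c hc c' hc' hcc
      have hodd : Odd c.supp.ncard := by simpa using hc
      rw [← hcard] at hodd
      obtain ⟨x, hx⟩ := card_pos.1 hodd.pos
      exact hinj c c' x hx (hcc ▸ hx)

variable {W : Type*} {G : SimpleGraph W} {U : Finset W} {O : Finset (Finset W)}

theorem sum_card_filter_le {ι : Type*} [DecidableEq W] (hO : G.IsOddFamily U O) (Z : Finset ι)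
    (f : ι → W) : ∑ C ∈ O, #{z ∈ Z | f z ∈ C} ≤ #Z := by
  simp only [card_filter]
  rw [sum_comm, card_eq_sum_ones]
  refine sum_le_sum fun z _ => ?_
  rw [← card_filter, card_le_one]
  simp only [mem_filter]
  exact fun C hC D hD => hO.pairwise C hC.1 D hD.1 _ hC.2 hD.2

theorem card_filter_mem_le [DecidableEq W] (hO : G.IsOddFamily U O) (x : W) :
    #{C ∈ O | x ∈ C} ≤ 1 := by
  rw [card_le_one]
  simp only [mem_filter]
  exact fun C hC D hD => hO.pairwise C hC.1 D hD.1 _ hC.2 hD.2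

-- Parity: if `#O = #U + 1` and the vertex set is even, the vertices outside `U` and all members
-- form one more odd set. It may be disconnected, which the family permits.
open scoped Classical in
theorem exists_add_two_le [Fintype W] (hW : Even (Fintype.card W)) (hO : G.IsOddFamily U O)
    (h : #U < #O) : ∃ O', G.IsOddFamily U O' ∧ #U + 2 ≤ #O' := by
  by_cases h2 : #U + 2 ≤ #O
  · exact ⟨O, hO, h2⟩
  have h3 : #O = #U + 1 := by omega
  set R : Finset W := O.biUnion id with hR
  have hRU : Disjoint U R := by
    rw [Finset.disjoint_left]
    intro x hx hxR
    simp only [hR, mem_biUnion, id] at hxR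
    obtain ⟨C, hC, hxC⟩ := hxR
    exact hO.disj C hC x hxC hx
  have hRcard : #R = ∑ C ∈ O, #C := by
    rw [hR, card_biUnion]
    · rfl
    · intro C hC D hD hCD
      rw [Function.onFun, Finset.disjoint_left]
      exact fun x hx hx' => hCD (hO.pairwise C hC D hD x hx hx')
  have hpar : (∑ C ∈ O, #C) % 2 = #O % 2 := by
    rw [sum_nat_mod, sum_congr rfl (fun C hC => Nat.odd_iff.1 (hO.odd_card C hC))]
    simp
  set D : Finset W := (U ∪ R)ᶜ with hD
  have hDcard : #D + (#U + #R) = Fintype.card W := by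
    rw [← card_union_of_disjoint hRU, hD, card_compl_add_card]
  have hDodd : Odd #D := by
    rw [Nat.even_iff] at hW
    rw [Nat.odd_iff]
    omega
  have hDdisj : ∀ C ∈ O, ∀ x ∈ C, x ∉ D := by
    intro C hC x hx hxD
    simp only [hD, mem_compl, mem_union, not_or, hR, mem_biUnion, id] at hxD
    exact hxD.2 ⟨C, hC, hx⟩
  have hDO : D ∉ O := by
    intro hDO
    obtain ⟨x, hx⟩ := card_pos.1 hDodd.pos
    exact hDdisj D hDO x hx hx
  refine ⟨insert D O, ⟨?_, ?_, ?_, ?_⟩, ?_⟩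
  · simp only [mem_insert]
    rintro C (rfl | hC)
    · exact hDodd
    · exact hO.odd_card C hC
  · simp only [mem_insert]
    rintro C (rfl | hC) x hx
    · simp only [hD, mem_compl, mem_union, not_or] at hx
      exact hx.1
    · exact hO.disj C hC x hx
  · simp only [mem_insert]
    rintro C (rfl | hC) C' (rfl | hC') x hx hx'
    · rfl
    · exact absurd hx (hDdisj C' hC' x hx')
    · exact absurd hx' (hDdisj C hC x hx)
    · exact hO.pairwise C hC C' hC' x hx hx'
  · simp only [mem_insert]
    rintro C (rfl | hC) x hx y hxy hy
    · by_contra hyD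
      simp only [hD, mem_compl, not_not, mem_union, hy, false_or, hR, mem_biUnion, id] at hyD
      obtain ⟨C, hC, hyC⟩ := hyD
      have hxU : x ∉ U := fun hxU => by simp [hD, hxU] at hx
      exact hDdisj C hC x (hO.closed C hC y hyC x hxy.symm hxU) hx
    · exact hO.closed C hC x hx y hxy hy
  · rw [card_insert_of_notMem hDO]
    omega

open scoped Classical in
/-- A minimal barrier: every vertex of `U` is adjacent to at least three members of the family. -/
theorem exists_minimal [Fintype W] (hW : Even (Fintype.card W))
    (h : ∀ M : G.Subgraph, ¬ M.IsPerfectMatching) :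
    ∃ U O, G.IsOddFamily U O ∧ #U + 2 ≤ #O ∧
      ∀ x ∈ U, 3 ≤ #{C ∈ O | ∃ y ∈ C, G.Adj x y} := by
  have hex : ∃ n : ℕ, ∃ U O, G.IsOddFamily U O ∧ #U < #O ∧ #U = n := by
    obtain ⟨U, O, hO, hlt⟩ := exists_of_forall_not_isPerfectMatching G h
    exact ⟨_, U, O, hO, hlt, rfl⟩
  obtain ⟨U, O₀, hO₀, hlt, hn⟩ := Nat.find_spec hex
  obtain ⟨O, hO, h2⟩ := hO₀.exists_add_two_le hW hlt
  refine ⟨U, O, hO, h2, fun x hx => ?_⟩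
  by_contra h3
  have hpos : 0 < #U := card_pos.2 ⟨x, hx⟩
  have hcard := card_erase_of_mem hx
  -- Removing `x` and the at most two members it touches keeps `#U < #O`, thanks to the surplus of
  -- 2.
  refine Nat.find_min hex (m := #(U.erase x)) (by omega)
    ⟨U.erase x, {C ∈ O | ¬ ∃ y ∈ C, G.Adj x y}, ⟨?_, ?_, ?_, ?_⟩, ?_, rfl⟩
  · exact fun C hC => hO.odd_card C (mem_filter.1 hC).1
  · exact fun C hC y hy hyU => hO.disj C (mem_filter.1 hC).1 y hy (mem_of_mem_erase hyU)
  · exact fun C hC D hD => hO.pairwise C (mem_filter.1 hC).1 D (mem_filter.1 hD).1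
  · intro C hC y hy z hyz hz
    rw [mem_filter] at hC
    refine hO.closed C hC.1 y hy z hyz fun hzU => hz (mem_erase.2 ⟨?_, hzU⟩)
    rintro rfl
    exact hC.2 ⟨y, hy, hyz.symm⟩
  · have := card_filter_add_card_filter_not (s := O) (fun C => ∃ y ∈ C, G.Adj x y)
    omega

end SimpleGraph.IsOddFamily

/-! ### Half-edges and the gadget graph -/

section HalfEdge

variable {V E : Type*} (p : E × Bool → V) (m : ℕ)

/-- The other half of the edge that the half-edge `h` belongs to. -/
def halfFlip {E : Type*} (h : E × Bool) : E × Bool := (h.1, !h.2)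

@[simp] theorem halfFlip_halfFlip {E : Type*} (h : E × Bool) : halfFlip (halfFlip h) = h := by
  simp [halfFlip]

theorem halfFlip_ne {E : Type*} (h : E × Bool) : halfFlip h ≠ h := by
  intro h'
  simpa [halfFlip] using congrArg Prod.snd h'

theorem eq_or_eq_halfFlip {E : Type*} {g h : E × Bool} (hgh : g.1 = h.1) :
    g = h ∨ g = halfFlip h := by
  obtain ⟨e, b⟩ := g
  obtain ⟨e', b'⟩ := h
  cases b <;> cases b' <;> simp_all [halfFlip]

/-- Adjacency in Tutte's gadget graph. -/
def gadgetAdj : (E × Bool) ⊕ (V × Fin m) → (E × Bool) ⊕ (V × Fin m) → Prop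
  | .inl g, .inl h => h = halfFlip g
  | .inl g, .inr b => p g = b.1
  | .inr b, .inl g => p g = b.1
  | .inr _, .inr _ => False

/-- Tutte's gadget graph of the multigraph whose half-edge `h` is attached to the vertex `p h`:
the two halves of each edge are adjacent, and the half-edges at a vertex are completely joined to
`m` new vertices. -/
def gadget : SimpleGraph ((E × Bool) ⊕ (V × Fin m)) where
  Adj := gadgetAdj p m
  symm := ⟨by
    rintro (g | b) (h | c) hgh
    · simp only [gadgetAdj] at hgh ⊢
      simp [hgh]
    · exact hgh
    · exact hgh
    · exact hgh⟩
  loopless := ⟨by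
    rintro (g | b) hg
    · exact halfFlip_ne g hg.symm
    · exact hg⟩

variable {p m}

@[simp] theorem gadget_adj_inl_inl {g h : E × Bool} :
    (gadget p m).Adj (.inl g) (.inl h) ↔ h = halfFlip g := Iff.rfl

@[simp] theorem gadget_adj_inl_inr {g : E × Bool} {b : V × Fin m} :
    (gadget p m).Adj (.inl g) (.inr b) ↔ p g = b.1 := Iff.rfl

@[simp] theorem gadget_adj_inr_inl {g : E × Bool} {b : V × Fin m} :
    (gadget p m).Adj (.inr b) (.inl g) ↔ p g = b.1 := Iff.rfl

@[simp] theorem gadget_adj_inr_inr {b c : V × Fin m} :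
    ¬ (gadget p m).Adj (.inr b) (.inr c) := fun h => h

open scoped Classical in
/-- A perfect matching of the gadget graph of a `d`-regular multigraph gives a
`(d - m)`-factor. -/
theorem exists_factor_of_isPerfectMatching [Fintype E] {l d : ℕ} (hd : d = l + m)
    (hreg : ∀ v, #{h | p h = v} = d) {M : (gadget p m).Subgraph} (hM : M.IsPerfectMatching) :
    ∃ F : Set E, ∀ v, #{h | p h = v ∧ h.1 ∈ F} = l := by
  have hex : ∀ x, ∃! y, M.Adj x y := fun x => hM.1 (hM.2 x)
  have hF : ∀ h : E × Bool, h.1 ∈ {e : E | M.Adj (.inl (e, false)) (.inl (e, true))} ↔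
      M.Adj (.inl h) (.inl (halfFlip h)) := by
    rintro ⟨e, b⟩
    cases b
    · rfl
    · exact M.adj_comm _ _
  refine ⟨{e | M.Adj (.inl (e, false)) (.inl (e, true))}, fun v => ?_⟩
  have hfil : ({h | p h = v ∧ h.1 ∈ {e : E | M.Adj (.inl (e, false)) (.inl (e, true))}} :
      Finset (E × Bool)) = {h ∈ ({h | p h = v} : Finset (E × Bool)) |
        M.Adj (.inl h) (.inl (halfFlip h))} := by
    ext h
    simp [← hF]
  have hsum := card_filter_add_card_filter_not (s := ({h | p h = v} : Finset (E × Bool)))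
    (fun h => M.Adj (.inl h) (.inl (halfFlip h)))
  -- The half-edges at `v` not matched to their other half are exactly the partners of the `m` new
  -- vertices.
  have hm : #{h ∈ ({h | p h = v} : Finset (E × Bool)) |
      ¬ M.Adj (.inl h) (.inl (halfFlip h))} = m := by
    have hb : ∀ i : Fin m, ∃ h : E × Bool, M.Adj (.inr (v, i)) (.inl h) := by
      intro i
      obtain ⟨y, hy, -⟩ := hex (.inr (v, i))
      rcases y with h | c
      · exact ⟨h, hy⟩
      · exact absurd (M.adj_sub hy) gadget_adj_inr_inr
    choose f hf using hb
    conv_rhs => rw [← Fintype.card_fin m, ← card_univ]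
    symm
    refine card_bij (fun i _ => f i) ?_ ?_ ?_
    · intro i _
      simp only [mem_filter, mem_univ, true_and]
      refine ⟨M.adj_sub (hf i), fun h => ?_⟩
      simpa using (hex _).unique (hf i).symm h
    · intro i _ j _ hij
      have h1 := (hf i).symm
      have h2 := (hf j).symm
      rw [hij] at h1
      simpa using (hex _).unique h1 h2
    · intro h hh
      simp only [mem_filter, mem_univ, true_and] at hh
      obtain ⟨y, hy, -⟩ := hex (.inl h)
      rcases y with g | ⟨w, i⟩
      · have := M.adj_sub hy
        rw [gadget_adj_inl_inl] at this
        exact absurd (this ▸ hy) hh.2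
      · have hw : p h = w := M.adj_sub hy
        obtain rfl : v = w := hh.1.symm.trans hw
        refine ⟨i, mem_univ _, ?_⟩
        simpa using (hex _).unique (hf i) hy.symm
  rw [hfil]
  rw [hm, hreg v] at hsum
  omega

/-- The edge `e` is the only edge joining some vertex set to its complement. -/
def IsSeparatingEdge (p : E × Bool → V) (e : E) : Prop :=
  ∃ (h : E × Bool) (X : Set V), h.1 = e ∧ p h ∈ X ∧ p (halfFlip h) ∉ X ∧
    ∀ g, g.1 ≠ e → p g ∈ X → p (halfFlip g) ∈ X

end HalfEdge

open scoped Classical in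
/-- If a `d`-regular multigraph with `d = l + m` has no `l`-factor, then its gadget graph has a
barrier in which exactly the half-edges at vertices of some set `S` and the new vertices at vertices of
some set `T` are removed. -/
theorem exists_barrier {V E : Type*} [Fintype V] [Fintype E] {p : E × Bool → V} {m l d : ℕ}
    (hd : d = l + m) (heven : Even (d + m)) (hreg : ∀ v, #{h | p h = v} = d)
    (hno : ¬ ∃ F : Set E, ∀ v, #{h | p h = v ∧ h.1 ∈ F} = l) :
    ∃ (S T : Finset V) (U : Finset ((E × Bool) ⊕ (V × Fin m))) (O : Finset (Finset _)),
      (gadget p m).IsOddFamily U O ∧ #U + 2 ≤ #O ∧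
      (∀ h, .inl h ∈ U ↔ p h ∈ S) ∧ (∀ b, .inr b ∈ U ↔ b.1 ∈ T) := by
  have hcardE : Fintype.card (E × Bool) = Fintype.card V * d := by
    rw [← card_univ, card_eq_sum_card_fiberwise (f := p) (t := univ) (by simp)]
    simp [hreg]
  have hW : Even (Fintype.card ((E × Bool) ⊕ (V × Fin m))) := by
    rw [Fintype.card_sum, hcardE, Fintype.card_prod, Fintype.card_fin, ← mul_add]
    exact heven.mul_left _
  have hM : ∀ M : (gadget p m).Subgraph, ¬ M.IsPerfectMatching :=
    fun M hM => hno (exists_factor_of_isPerfectMatching hd hreg hM)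
  obtain ⟨U, O, hO, h2, hU⟩ := SimpleGraph.IsOddFamily.exists_minimal hW hM
  have hone := hO.card_filter_mem_le
  -- Twin new vertices have the same neighbours, so `(v, i)` touches only the member containing `(v,
  -- j)`.
  have hB : ∀ v i j, .inr (v, i) ∈ U → .inr (v, j) ∈ U := by
    intro v i j hi
    by_contra hj
    have h3 := hU _ hi
    have := hone (.inr (v, j))
    have hsub : #{C ∈ O | ∃ y ∈ C, (gadget p m).Adj (.inr (v, i)) y} ≤
        #{C ∈ O | .inr (v, j) ∈ C} := by
      refine card_le_card fun C hC => ?_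
      rw [mem_filter] at hC ⊢
      obtain ⟨hC, y, hy, hadj⟩ := hC
      refine ⟨hC, ?_⟩
      rcases y with h | c
      · rw [gadget_adj_inr_inl] at hadj
        exact hO.closed C hC _ hy _ (gadget_adj_inl_inr.2 hadj) hj
      · exact absurd hadj gadget_adj_inr_inr
    omega
  -- Here `g` touches at most two members: that of its other half, and that of `h`, which absorbs
  -- every new vertex at `p g` outside `U`.
  have hA : ∀ g h, p g = p h → .inl g ∈ U → .inl h ∈ U := by
    intro g h hgh hg
    by_contra hh
    have h3 := hU _ hg
    have h4 := hone (.inl (halfFlip g))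
    have h5 := hone (.inl h)
    have hsub : #{C ∈ O | ∃ y ∈ C, (gadget p m).Adj (.inl g) y} ≤
        #({C ∈ O | .inl (halfFlip g) ∈ C} ∪ {C ∈ O | .inl h ∈ C}) := by
      refine card_le_card fun C hC => ?_
      rw [mem_union, mem_filter, mem_filter]
      rw [mem_filter] at hC
      obtain ⟨hC, y, hy, hadj⟩ := hC
      rcases y with g' | c
      · rw [gadget_adj_inl_inl] at hadj
        exact .inl ⟨hC, hadj ▸ hy⟩
      · rw [gadget_adj_inl_inr, hgh] at hadj
        exact .inr ⟨hC, hO.closed C hC _ hy _ (gadget_adj_inr_inl.2 hadj) hh⟩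
    have := card_union_le {C ∈ O | .inl (halfFlip g) ∈ C} {C ∈ O | .inl h ∈ C}
    omega
  refine ⟨({v | ∃ h, p h = v ∧ .inl h ∈ U} : Finset V), ({v | ∃ i, .inr (v, i) ∈ U} : Finset V),
    U, O, hO, h2, ?_, ?_⟩
  · intro h
    simp only [mem_filter, mem_univ, true_and]
    exact ⟨fun hh => ⟨h, rfl, hh⟩, fun ⟨g, hg, hg'⟩ => hA g h hg hg'⟩
  · rintro ⟨v, i⟩
    simp only [mem_filter, mem_univ, true_and]
    exact ⟨fun hi => ⟨i, hi⟩, fun ⟨j, hj⟩ => hB v j i hj⟩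

/-! ### Structure of the members of the odd family -/

section Members

variable {V E : Type*} {p : E × Bool → V} {m d : ℕ}
  {S T : Finset V} {U : Finset ((E × Bool) ⊕ (V × Fin m))}
  {O : Finset (Finset ((E × Bool) ⊕ (V × Fin m)))} {C : Finset ((E × Bool) ⊕ (V × Fin m))}

theorem inl_mem_of_inl_mem (hm : 0 < m) (hO : (gadget p m).IsOddFamily U O)
    (hS : ∀ h, .inl h ∈ U ↔ p h ∈ S) (hT : ∀ b, .inr b ∈ U ↔ b.1 ∈ T) (hC : C ∈ O)
    {g h : E × Bool} (hgh : p g = p h) (hgT : p g ∉ T) (hg : .inl g ∈ C) : .inl h ∈ C := by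
  have h1 : .inr (p g, ⟨0, hm⟩) ∈ C :=
    hO.closed C hC _ hg _ (gadget_adj_inl_inr.2 rfl) (by rwa [hT])
  refine hO.closed C hC _ h1 _ (gadget_adj_inr_inl.2 hgh.symm) ?_
  rw [hS, ← hgh, ← hS]
  exact hO.disj C hC _ hg

-- The rest of `C` is even: a vertex outside `S ∪ T` contributes nothing or all its `d` half-edges
-- and `m` new vertices, and a vertex of `S` or `T` contributes nothing to it.
open scoped Classical in
theorem odd_card_filter_of_forall_inr [Fintype V] [Fintype E] (hm : 0 < m) (hdpos : 0 < d)
    (heven : Even (d + m))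
    (hreg : ∀ v, #{h | p h = v} = d) (hO : (gadget p m).IsOddFamily U O)
    (hS : ∀ h, .inl h ∈ U ↔ p h ∈ S) (hT : ∀ b, .inr b ∈ U ↔ b.1 ∈ T) (hC : C ∈ O)
    (hCS : ∀ b, .inr b ∈ C → b.1 ∉ S) :
    Odd #{h | p h ∈ T ∧ .inl h ∈ C} := by
  have hcard : #C = #{h | p h ∈ T ∧ .inl h ∈ C} +
      (#{h | p h ∉ T ∧ .inl h ∈ C} + #{b | .inr b ∈ C}) := by
    have h1 : C = ({h | .inl h ∈ C} : Finset (E × Bool)).disjSum {b | .inr b ∈ C} := by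
      ext x
      rcases x with h | b <;> simp
    have h2 := card_filter_add_card_filter_not (s := ({h | .inl h ∈ C} : Finset (E × Bool)))
      (fun h => p h ∈ T)
    rw [filter_filter, filter_filter] at h2
    conv_lhs => rw [h1, card_disjSum, ← h2]
    simp only [and_comm, add_assoc]
  have hev : Even (#{h | p h ∉ T ∧ .inl h ∈ C} + #{b | .inr b ∈ C}) := by
    rw [card_eq_sum_card_fiberwise (s := ({h | p h ∉ T ∧ .inl h ∈ C} : Finset (E × Bool)))
        (f := p) (t := univ) (by simp),
      card_eq_sum_card_fiberwise (s := ({b | .inr b ∈ C} : Finset (V × Fin m)))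
        (f := Prod.fst) (t := univ) (by simp), ← sum_add_distrib]
    refine even_sum _ fun v _ => ?_
    by_cases hv : v ∉ T ∧ v ∉ S ∧ ∃ i, .inr (v, i) ∈ C
    · obtain ⟨hvT, hvS, i, hi⟩ := hv
      have hl : ∀ h, p h = v → .inl h ∈ C := fun h hh =>
        hO.closed C hC _ hi _ (gadget_adj_inr_inl.2 hh) (by rwa [hS, hh])
      have h1 : ({h ∈ ({h | p h ∉ T ∧ .inl h ∈ C} : Finset (E × Bool)) | p h = v}) =
          ({h | p h = v} : Finset (E × Bool)) := by
        ext h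
        simp only [mem_filter, mem_univ, true_and]
        exact ⟨fun hh => hh.2, fun hh => ⟨⟨by rwa [hh], hl h hh⟩, hh⟩⟩
      obtain ⟨g, hg⟩ := card_pos.1 (hdpos.trans_eq (hreg v).symm)
      simp only [mem_filter, mem_univ, true_and] at hg
      have h2 : ({b ∈ ({b | .inr b ∈ C} : Finset (V × Fin m)) | b.1 = v}) =
          ({v} : Finset V) ×ˢ univ := by
        ext ⟨w, j⟩
        simp only [mem_filter, mem_univ, true_and, mem_product, mem_singleton, and_true]
        refine ⟨fun hh => hh.2, fun hh => ⟨?_, hh⟩⟩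
        exact hO.closed C hC _ (hl g hg) _ (gadget_adj_inl_inr.2 (hg.trans hh.symm))
          (by rw [hT]; simpa [hh] using hvT)
      rw [h1, h2, hreg, card_product, card_singleton, card_univ, Fintype.card_fin, one_mul]
      exact heven
    · have h2 : ({b ∈ ({b | .inr b ∈ C} : Finset (V × Fin m)) | b.1 = v}) = ∅ := by
        refine filter_eq_empty_iff.2 fun b hb hbv => hv ?_
        subst hbv
        simp only [mem_filter, mem_univ, true_and] at hb
        refine ⟨fun hbT => hO.disj C hC _ hb ((hT b).2 hbT), hCS b hb, b.2, hb⟩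
      have h1 : ({h ∈ ({h | p h ∉ T ∧ .inl h ∈ C} : Finset (E × Bool)) | p h = v}) = ∅ := by
        refine filter_eq_empty_iff.2 fun h hh hhv => hv ?_
        subst hhv
        simp only [mem_filter, mem_univ, true_and] at hh
        refine ⟨hh.1, fun hhS => hO.disj C hC _ hh.2 ((hS h).2 hhS), ⟨0, hm⟩, ?_⟩
        exact hO.closed C hC _ hh.2 _ (gadget_adj_inl_inr.2 rfl) (by rw [hT]; exact hh.1)
      rw [h1, h2]
      simp
  have hodd := hO.odd_card C hC
  rw [hcard, Nat.odd_add] at hodd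
  exact hodd.2 hev

-- Take the vertices outside `T` with a half-edge in `C`. All half-edges at them lie in `C`, and so
-- do the opposite halves; an edge can thus leave this set only through the unique half-edge of `C`
-- at `T`.
open scoped Classical in
theorem isSeparatingEdge_of_card_eq_one [Fintype E] (hm : 0 < m)
    (hO : (gadget p m).IsOddFamily U O)
    (hS : ∀ h, .inl h ∈ U ↔ p h ∈ S) (hT : ∀ b, .inr b ∈ U ↔ b.1 ∈ T) (hC : C ∈ O)
    (h1 : #{h | p h ∈ T ∧ .inl h ∈ C} = 1)
    (h0 : ∀ h, .inl h ∈ C → .inl (halfFlip h) ∉ U) :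
    ∃ h, .inl h ∈ C ∧ .inl (halfFlip h) ∈ C ∧ IsSeparatingEdge p h.1 := by
  obtain ⟨h, hh⟩ := card_eq_one.1 h1
  have hiff : ∀ g, p g ∈ T ∧ .inl g ∈ C ↔ g = h := by
    intro g
    simpa using Finset.ext_iff.1 hh g
  obtain ⟨hhT, hhC⟩ := (hiff h).2 rfl
  have hflip : ∀ g, .inl g ∈ C → .inl (halfFlip g) ∈ C := fun g hg =>
    hO.closed C hC _ hg _ (gadget_adj_inl_inl.2 rfl) (h0 g hg)
  refine ⟨h, hhC, hflip h hhC, halfFlip h, {v | v ∉ T ∧ ∃ g, p g = v ∧ .inl g ∈ C}, rfl, ?_, ?_, ?_⟩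
  · refine ⟨fun hT' => ?_, _, rfl, hflip h hhC⟩
    exact halfFlip_ne h ((hiff _).1 ⟨hT', hflip h hhC⟩)
  · rw [halfFlip_halfFlip]
    exact fun hX => hX.1 hhT
  · rintro g hge ⟨hgT, g', hg', hg'C⟩
    have hgC : .inl g ∈ C :=
      inl_mem_of_inl_mem hm hO hS hT hC hg' (by rwa [hg']) hg'C
    refine ⟨fun hT' => hge ?_, _, rfl, hflip g hgC⟩
    have := (hiff _).1 ⟨hT', hflip g hgC⟩
    rw [← this]
    rfl

end Members

/-! ### The counting argument -/

open scoped Classical in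
/-- A `(2r+1)`-regular multigraph with no `2k`-factor has many separating edges. -/
theorem card_isSeparatingEdge_of_no_factor {V E : Type*} [Fintype V] [Fintype E]
    {p : E × Bool → V} {r k : ℕ} (hkr : 3 * k ≤ 2 * r + 1)
    (hreg : ∀ v, #{h | p h = v} = 2 * r + 1)
    (hno : ¬ ∃ F : Set E, ∀ v, #{h | p h = v ∧ h.1 ∈ F} = 2 * k) :
    2 * r + 1 + 3 ≤ #{e | IsSeparatingEdge p e} + 3 * k := by
  obtain ⟨m, hd⟩ : ∃ m, 2 * r + 1 = 2 * k + m := ⟨2 * r + 1 - 2 * k, by omega⟩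
  have hm : 0 < m := by omega
  have heven : Even (2 * r + 1 + m) := by rw [Nat.even_iff]; omega
  obtain ⟨S, T, U, O, hO, h2, hS, hT⟩ := exists_barrier hd heven hreg hno
  have hfib : ∀ X : Finset V, #{h | p h ∈ X} = (2 * r + 1) * #X := by
    intro X
    rw [card_eq_sum_card_fiberwise (f := p) (t := X) (fun h hh => by simpa using hh),
      sum_congr rfl (g := fun _ => 2 * r + 1), sum_const, smul_eq_mul, mul_comm]
    intro v hv
    rw [← hreg v, filter_filter]
    congr 1
    ext h
    simp only [mem_filter, mem_univ, true_and]
    exact ⟨fun h => h.2, fun h => ⟨by rwa [h], h⟩⟩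
  have hU : #U = (2 * r + 1) * #S + m * #T := by
    have h1 : U = ({h | p h ∈ S} : Finset (E × Bool)).disjSum (T ×ˢ univ) := by
      ext x
      rcases x with h | b <;> simp [hS, hT]
    rw [h1, card_disjSum, hfib, card_product, card_univ, Fintype.card_fin, mul_comm #T]
  let τ : Finset ((E × Bool) ⊕ (V × Fin m)) → ℕ := fun C => #{h | p h ∈ T ∧ .inl h ∈ C}
  let σ : Finset ((E × Bool) ⊕ (V × Fin m)) → ℕ := fun C => #{h | p h ∈ S ∧ .inl (halfFlip h) ∈ C}
  let β : Finset ((E × Bool) ⊕ (V × Fin m)) → ℕ := fun C => #{b | b.1 ∈ S ∧ .inr b ∈ C}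
  have hτ : ∑ C ∈ O, τ C ≤ (2 * r + 1) * #T := by
    rw [← hfib]
    simpa only [filter_filter] using hO.sum_card_filter_le ({h | p h ∈ T} : Finset (E × Bool)) Sum.inl
  have hσ : ∑ C ∈ O, σ C ≤ (2 * r + 1) * #S := by
    rw [← hfib]
    simpa only [filter_filter] using
      hO.sum_card_filter_le ({h | p h ∈ S} : Finset (E × Bool)) (fun h => Sum.inl (halfFlip h))
  have hβ : ∑ C ∈ O, β C ≤ m * #S := by
    have h1 : #({b | b.1 ∈ S} : Finset (V × Fin m)) = m * #S := by
      have : ({b | b.1 ∈ S} : Finset (V × Fin m)) = S ×ˢ univ := by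
        ext b
        simp
      rw [this, card_product, card_univ, Fintype.card_fin, mul_comm]
    rw [← h1]
    simpa only [filter_filter] using
      hO.sum_card_filter_le ({b | b.1 ∈ S} : Finset (V × Fin m)) Sum.inr
  set O₀ := {C ∈ O | β C = 0 ∧ σ C = 0 ∧ τ C = 1} with hO₀
  have hbridge : #O₀ ≤ #{e | IsSeparatingEdge p e} := by
    have hex : ∀ C ∈ O₀, ∃ h, .inl h ∈ C ∧ .inl (halfFlip h) ∈ C ∧ IsSeparatingEdge p h.1 := by
      intro C hC
      obtain ⟨hC, -, hσ0, hτ1⟩ := mem_filter.1 hC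
      refine isSeparatingEdge_of_card_eq_one hm hO hS hT hC hτ1 fun h hh hhU => ?_
      rw [hS] at hhU
      have := filter_eq_empty_iff.1 (card_eq_zero.1 hσ0) (mem_univ (halfFlip h))
      rw [halfFlip_halfFlip] at this
      exact this ⟨hhU, hh⟩
    obtain hemp | ⟨C₀, hC₀⟩ := O₀.eq_empty_or_nonempty
    · simp [hemp]
    obtain ⟨h₀, -⟩ := hex C₀ hC₀
    have : Nonempty (E × Bool) := ⟨h₀⟩
    choose! f hf1 hf2 hf3 using hex
    refine card_le_card_of_injOn (fun C => (f C).1) ?_ ?_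
    · intro C hC
      simpa using hf3 C hC
    · intro C hC D hD hCD
      have hC' := (mem_filter.1 hC).1
      have hD' := (mem_filter.1 hD).1
      -- Both halves of the chosen edge lie in its member, so a shared edge gives a shared element.
      rcases eq_or_eq_halfFlip hCD with h | h
      · exact hO.pairwise C hC' D hD' _ (hf1 C hC) (h ▸ hf1 D hD)
      · exact hO.pairwise C hC' D hD' _ (hf1 C hC) (h ▸ hf2 D hD)
  have hodd : ∀ C ∈ O, β C = 0 → Odd (τ C) := by
    intro C hC hC0
    refine odd_card_filter_of_forall_inr hm (by omega) heven hreg hO hS hT hC fun b hb hbS => ?_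
    exact filter_eq_empty_iff.1 (card_eq_zero.1 hC0) (mem_univ b) ⟨hbS, hb⟩
  /- Members with `σ = 0`, `τ = 1` are counted by `x`, those with `σ > 0`, `τ = 1` by `y` and those
  with `τ ≥ 3` by `z`. -/
  have hpt : ∀ C ∈ O, ∃ x y z : ℕ, x = (if β C = 0 ∧ σ C = 0 ∧ τ C = 1 then 1 else 0) ∧
      1 ≤ β C + x + y + z ∧ x + y + 3 * z ≤ τ C ∧ y ≤ σ C := by
    intro C hC
    by_cases hC0 : β C = 0
    · have h1 := Nat.odd_iff.1 (hodd C hC hC0)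
      by_cases hτ3 : 3 ≤ τ C
      · exact ⟨0, 0, 1, by rw [if_neg (by omega)], by omega, by omega, by omega⟩
      · by_cases hσ0 : σ C = 0
        · exact ⟨1, 0, 0, by rw [if_pos (by omega)], by omega, by omega, by omega⟩
        · exact ⟨0, 1, 0, by rw [if_neg (by omega)], by omega, by omega, by omega⟩
    · exact ⟨0, 0, 0, by rw [if_neg (by omega)], by omega, by omega, by omega⟩
  choose! x y z hx h1 h3 hy using hpt
  have hX : ∑ C ∈ O, x C = #O₀ := by
    rw [hO₀, card_filter]
    exact sum_congr rfl hx
  have hs1 := sum_le_sum h1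
  have hs3 := sum_le_sum h3
  have hsy := sum_le_sum hy
  simp only [sum_add_distrib, ← mul_sum, sum_const, smul_eq_mul, mul_one] at hs1 hs3 hsy
  rw [hU] at h2
  generalize ∑ C ∈ O, z C = Z at *
  generalize ∑ C ∈ O, y C = Y at *
  generalize ∑ C ∈ O, x C = X at *
  generalize ∑ C ∈ O, β C = B at *
  have hcount : (2 * r + 1) * #S + m * #T + 2 ≤ m * #S + X + Y + Z := by omega
  have hT' : X + Y + 3 * Z ≤ (2 * r + 1) * #T := by omega
  have hS' : Y ≤ (2 * r + 1) * #S := by omega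
  have hfin : 2 * r + 1 + 3 ≤ X + 3 * k := by
    generalize #S = s at *
    generalize #T = t at *
    have hmz : (m : ℤ) = 2 * r + 1 - 2 * k := by omega
    zify at hcount hT' hS' hkr ⊢
    rw [hmz] at hcount
    -- Bounding `X + Y` by `hT'` in `hcount` leaves only even terms.
    have hZ : (Z : ℤ) + 1 ≤ k * (t - s) := by
      have : 2 * ((Z : ℤ) + 1) ≤ 2 * (k * (t - s)) := by linarith
      linarith
    have hst : (1 : ℤ) ≤ t - s := by
      by_contra hlt
      have : (k : ℤ) * (t - s) ≤ 0 :=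
        mul_nonpos_of_nonneg_of_nonpos (by positivity) (by omega)
      have : (0 : ℤ) ≤ Z := by positivity
      linarith
    -- Now `hcount` is used again, with `Y` bounded by `hS'` and `Z` by `hZ`.
    have hX3 : (2 * r + 1 - 3 * k) * ((t : ℤ) - s) + 3 ≤ X := by linarith
    -- Since `3k ≤ 2r + 1`, the coefficient is nonnegative and the worst case is `t - s = 1`.
    have hmul : (2 * (r : ℤ) + 1 - 3 * k) * 1 ≤ (2 * r + 1 - 3 * k) * ((t : ℤ) - s) :=
      mul_le_mul_of_nonneg_left hst (by linarith)
    linarith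
  omega

/-! ### Transfer between half-edges and `Graph` -/

namespace Graph

variable {α β : Type*} {G : Graph α β} {p : E(G) × Bool → V(G)}

/-- With `A b` the edges of `F` whose half `b` is at `v`, incident edges form the union and loops
the intersection of `A false` and `A true`; the two cardinals add up to the number of half-edges. -/
theorem degree_restrict_eq_encard (hp : ∀ e : E(G), G.IsLink e (p (e, false)) (p (e, true)))
    (F : Set E(G)) (v : V(G)) :
    (G.restrict (Subtype.val '' F)).degree v = {h | p h = v ∧ h.1 ∈ F}.encard := by
  let A : Bool → Set E(G) := fun b => {e | p (e, b) = v ∧ e ∈ F}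
  have h1 : {e | (G.restrict (Subtype.val '' F)).Inc e v} =
      Subtype.val '' (A false ∪ A true) := by
    ext e
    simp only [Set.mem_ofPred_eq, restrict_inc, Set.mem_image, Set.mem_union, A]
    constructor
    · rintro ⟨hinc, e, he, rfl⟩
      refine ⟨e, ?_, rfl⟩
      rcases hinc.eq_or_eq_of_isLink (hp e) with h | h
      · exact .inl ⟨(Subtype.ext h).symm, he⟩
      · exact .inr ⟨(Subtype.ext h).symm, he⟩
    · rintro ⟨e, ⟨h, he⟩ | ⟨h, he⟩, rfl⟩
      · exact ⟨h ▸ (hp e).inc_left, e, he, rfl⟩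
      · exact ⟨h ▸ (hp e).inc_right, e, he, rfl⟩
  have h2 : {e | (G.restrict (Subtype.val '' F)).IsLoopAt e v} =
      Subtype.val '' (A false ∩ A true) := by
    ext e
    simp only [Set.mem_ofPred_eq, restrict_isLoopAt, Set.mem_image, Set.mem_inter_iff, A]
    constructor
    · rintro ⟨hloop, e, he, rfl⟩
      exact ⟨e, ⟨⟨(Subtype.ext (hloop.eq_of_inc (hp e).inc_left)).symm, he⟩,
        ⟨(Subtype.ext (hloop.eq_of_inc (hp e).inc_right)).symm, he⟩⟩, rfl⟩
    · rintro ⟨e, ⟨⟨h, he⟩, ⟨h', -⟩⟩, rfl⟩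
      have := hp e
      rw [h, h'] at this
      exact ⟨this, e, he, rfl⟩
  have h3 : {h | p h = v ∧ h.1 ∈ F} = (fun e => (e, false)) '' A false ∪
      (fun e => (e, true)) '' A true := by
    ext ⟨e, b⟩
    cases b <;> simp [A]
  have hinj : ∀ b : Bool, Function.Injective (fun e : E(G) => (e, b)) :=
    fun b e e' h => congrArg Prod.fst h
  rw [degree, h1, h2, Subtype.val_injective.encard_image, Subtype.val_injective.encard_image,
    Set.encard_union_add_encard_inter, h3, Set.encard_union_eq, (hinj _).encard_image,
    (hinj _).encard_image]
  rw [Set.disjoint_left]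
  rintro _ ⟨e, -, rfl⟩ ⟨e', -, h⟩
  simpa using congrArg Prod.snd h

open scoped Classical in
theorem degree_restrict_eq_card [Fintype E(G)]
    (hp : ∀ e : E(G), G.IsLink e (p (e, false)) (p (e, true))) (F : Set E(G)) (v : V(G)) :
    (G.restrict (Subtype.val '' F)).degree v = #{h | p h = v ∧ h.1 ∈ F} := by
  rw [degree_restrict_eq_encard hp, ← Set.encard_coe_eq_coe_finsetCard]
  simp

theorem isLink_halfFlip (hp : ∀ e : E(G), G.IsLink e (p (e, false)) (p (e, true)))
    (h : E(G) × Bool) : G.IsLink h.1 (p h) (p (halfFlip h)) := by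
  obtain ⟨e, b⟩ := h
  cases b
  · exact hp e
  · exact (hp e).symm

/-- Once the edge is deleted, no walk leaves the side `X`. -/
theorem isCutEdge_of_isSeparatingEdge
    (hp : ∀ e : E(G), G.IsLink e (p (e, false)) (p (e, true))) {e : E(G)}
    (he : IsSeparatingEdge p e) : G.IsCutEdge e := by
  obtain ⟨h, X, rfl, hX, hX', hclosed⟩ := he
  refine ⟨h.1.2, p h, (p h).2, p (halfFlip h), (p (halfFlip h)).2,
    .single ⟨_, isLink_halfFlip hp h⟩, fun hreach => ?_⟩
  have hmem : ∀ w, (G.deleteEdges {(h.1 : β)}).Reachable (p h) w → w ∈ Subtype.val '' X := by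
    intro w hw
    induction hw with
    | refl => exact ⟨_, hX, rfl⟩
    | @tail _ w _ hadj ih =>
      obtain ⟨u, huX, rfl⟩ := ih
      obtain ⟨f, hf⟩ := hadj
      rw [deleteEdges_isLink] at hf
      obtain ⟨hf, hfe⟩ := hf
      have key : ∀ g : E(G) × Bool, (g.1 : β) = f → (u : α) = p g → w ∈ Subtype.val '' X := by
        rintro g rfl hu
        have hu' : u = p g := Subtype.ext hu
        have hlink := isLink_halfFlip hp g
        rw [← hu] at hlink
        rw [hf.right_unique hlink]
        exact ⟨_, hclosed g (fun hg => hfe (by simp [hg])) (hu' ▸ huX), rfl⟩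
      rcases hf.left_eq_or_eq (hp ⟨f, hf.edge_mem⟩) with hu | hu
      · exact key (⟨f, hf.edge_mem⟩, false) rfl hu
      · exact key (⟨f, hf.edge_mem⟩, true) rfl hu
  obtain ⟨x, hx, hxe⟩ := hmem _ hreach
  exact hX' (Subtype.ext hxe ▸ hx)

end Graph

theorem theorem2p1 {α β : Type*} (r k : ℕ) (hr : 0 < r) (hk : 0 < k)
    (hkr : (k : ℚ) ≤ (2 * (r : ℚ) + 1) / 3)
    (G : Graph α β) (hV : V(G).Finite) (hE : E(G).Finite)
    (hreg : G.IsRegular (2 * r + 1))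
    (hcut : (G.cutEdges.ncard : ℤ) ≤ 2 * (r : ℤ) - 3 * ((k : ℤ) - 1)) :
    ∃ H : Graph α β, G.IsFactor (2 * k) H := by
  classical
  have : Fintype V(G) := hV.fintype
  have : Fintype E(G) := hE.fintype
  have hends : ∀ e : E(G), ∃ x y : V(G), G.IsLink e x y := by
    intro e
    obtain ⟨x, y, hxy⟩ := G.exists_isLink_of_mem_edgeSet e.2
    exact ⟨⟨x, hxy.left_mem⟩, ⟨y, hxy.right_mem⟩, hxy⟩
  choose a b hab using hends
  let p : E(G) × Bool → V(G) := fun h => cond h.2 (b h.1) (a h.1)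
  have hp : ∀ e : E(G), G.IsLink e (p (e, false)) (p (e, true)) := hab
  have hkr' : 3 * k ≤ 2 * r + 1 := by
    have : (3 * k : ℚ) ≤ 2 * r + 1 := by linarith
    exact_mod_cast this
  have hpreg : ∀ v, #{h | p h = v} = 2 * r + 1 := by
    intro v
    have h1 := Graph.degree_restrict_eq_card hp Set.univ v
    rw [Set.image_univ, Subtype.range_coe, Graph.restrict_self, hreg v v.2] at h1
    simp only [Set.mem_univ, and_true] at h1
    exact_mod_cast h1.symm
  have hsep : #{e | IsSeparatingEdge p e} ≤ G.cutEdges.ncard := by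
    rw [← card_map (Function.Embedding.subtype _), ← Set.ncard_coe_finset]
    refine Set.ncard_le_ncard ?_ (hE.subset fun e he => he.1)
    intro e he
    simp only [coe_map, Set.mem_image, mem_coe, mem_filter, mem_univ, true_and] at he
    obtain ⟨e, he, rfl⟩ := he
    exact Graph.isCutEdge_of_isSeparatingEdge hp he
  obtain ⟨F, hF⟩ : ∃ F : Set E(G), ∀ v, #{h | p h = v ∧ h.1 ∈ F} = 2 * k := by
    by_contra hno
    have := card_isSeparatingEdge_of_no_factor (p := p) hkr' (fun v => by convert hpreg v)
      (fun ⟨F, hF⟩ => hno ⟨F, fun v => by convert hF v⟩)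
    omega
  refine ⟨G.restrict (Subtype.val '' F), ⟨Graph.restrict_le, rfl⟩, fun v hv => ?_⟩
  rw [Graph.degree_restrict_eq_card hp F ⟨v, hv⟩, hF]
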